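/- Work in the unit ball model. Let $\langle z,w\rangle=z_1\overline{w_1}+z_2\overline{w_2}-z_3\overline{w_3}$ on $\mathbb{C}^3$, and let $\mathbf{H}^2_{\mathbb C}\subset\mathbb{CP}^2$ and $\partial\mathbf{H}^2_{\mathbb C}$ be the projectivizations of the vectors with $\langle z,z\rangle<0$ and of the nonzero vectors with $\langle z,z\rangle=0$; $\mathbf{H}^2_{\mathbb C}$ carries the Bergman distance, $\cosh^2(d(u,v)/2)=\frac{\langle u,v\rangle\langle v,u\rangle}{\langle u,u\rangle\langle v,v\rangle}$. Let $\mathrm{PU}(2,1)=\mathrm{U}(2,1)/\mathrm{U}(1)$ be its group of holomorphic isometries. An element of $\mathrm{PU}(2,1)$ is elliptic if it fixes a point of $\mathbf{H}^2_{\mathbb C}$, regular elliptic if moreover its lifts to $\mathrm{U}(2,1)$ have three distinct eigenvalues, and real elliptic with angle $\theta$ if it is elliptic and conjugate in $\mathrm{PU}(2,1)$ to the class of $\mathrm{diag}(e^{i\theta},e^{-i\theta},1)$; it is real elliptic if this holds for some $\theta$. A Lagrangian plane is a totally geodesic plane in $\mathbf{H}^2_{\mathbb C}$ isometric to the real hyperbolic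 plane $\mathbf{H}^2_{\mathbb R}=\{[x,y,1]: x,y\in\mathbb{R},\ x^2+y^2<1\}$ (with the Bergman distance). The ideal boundary of $U\subset\mathbf{H}^2_{\mathbb C}$ is $\partial_\infty U=\overline U\cap\partial\mathbf{H}^2_{\mathbb C}$. For a regular, real elliptic isometry $f$ with fixed point $p_f\in\mathbf{H}^2_{\mathbb C}$, the fixed torus $\mathbb{T}^2_f\subset\partial\mathbf{H}^2_{\mathbb C}$ is the union of the ideal boundaries $\partial_\infty L$ over all Lagrangian planes $L$ such that $p_f\in L$, $f(L)=L$ and $f|_L$ is not an involution. **Theorem.** Let $f\in\mathrm{PU}(2,1)$ be a regular, real elliptic isometry with fixed point $p_f$ and fixed torus $\mathbb{T}^2_f$. Then there is a one-parameter subgroup $G=\{f_\theta\mid\theta\in[0,2\pi)\}\le\mathrm{PU}(2,1)$ (that is, $\theta\mapsto f_\theta$ is the restriction to $[0,2\pi)$ of a continuous homomorphism $\mathbb{R}\to\mathrm{PU}(2,1)$ with image $G$), isomorphic to $\mathrm{SO}(2)$ as a topological group, such that $f\in G$ and, for every $\theta\in[0,2\pi)$, $f_\theta$ is real elliptic with angle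 $\theta$ and, if $f_\theta$ is regular elliptic, then $p_f$ is the unique fixed point of $f_\theta$ in $\mathbf{H}^2_{\mathbb C}$ and the fixed torus of $f_\theta$ is $\mathbb{T}^2_f$. -/

import Mathlib

open scoped LinearAlgebra.Projectivization Matrix

noncomputable section

namespace CHyp

/-- The Hermitian matrix `diag (1, 1, -1)` of signature `(2, 1)` (unit ball model). -/
def J : Matrix (Fin 3) (Fin 3) ℂ := Matrix.diagonal ![1, 1, -1]

/-- The Hermitian form `⟨z, w⟩ = w* J z`. -/
def herm (z w : Fin 3 → ℂ) : ℂ := star w ⬝ᵥ (J *ᵥ z)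

/-- The complex projective plane. -/
abbrev CP2 : Type := ℙ ℂ (Fin 3 → ℂ)

/-- The usual (quotient) topology of the complex projective plane. -/
instance instTopologicalSpaceCP2 : TopologicalSpace CP2 :=
  TopologicalSpace.coinduced
    (fun v : {v : Fin 3 → ℂ // v ≠ 0} => Projectivization.mk ℂ v.1 v.2) inferInstance

/-- The complex hyperbolic plane: the projectivized negative cone. -/
def H2 : Set CP2 := {p | (herm p.rep p.rep).re < 0}

/-- The boundary of the complex hyperbolic plane: the projectivized null cone. -/
def bdH2 : Set CP2 := {p | (herm p.rep p.rep).re = 0}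

/-- The Bergman distance, `cosh² (d(u, v) / 2) = ⟨u, v⟩ ⟨v, u⟩ / (⟨u, u⟩ ⟨v, v⟩)`.
It is meant for `u` and `v` in `H2`; the value does not depend on the lifts. -/
def bergmanDist (u v : CP2) : ℝ :=
  2 * Real.arcosh (Real.sqrt
    ((herm u.rep v.rep * herm v.rep u.rep) / (herm u.rep u.rep * herm v.rep v.rep)).re)

/-- The ideal boundary of a subset of the complex hyperbolic plane. -/
def idealBoundary (U : Set CP2) : Set CP2 := closure U ∩ bdH2

/-! ### The group `PU(2,1)` -/

/-- The unitary group `U(2,1)` of the form `herm`. -/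
def U21 : Subgroup (GL (Fin 3) ℂ) where
  carrier := {A | (A : Matrix (Fin 3) (Fin 3) ℂ)ᴴ * J * (A : Matrix (Fin 3) (Fin 3) ℂ) = J}
  one_mem' := by simp
  mul_mem' := by
    intro A B hA hB
    simp only [Set.mem_ofPred_eq] at hA hB ⊢
    rw [Units.val_mul, Matrix.conjTranspose_mul]
    calc _ = (B : Matrix (Fin 3) (Fin 3) ℂ)ᴴ *
          ((A : Matrix (Fin 3) (Fin 3) ℂ)ᴴ * J * (A : Matrix (Fin 3) (Fin 3) ℂ)) *
          (B : Matrix (Fin 3) (Fin 3) ℂ) := by simp only [Matrix.mul_assoc]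
      _ = J := by rw [hA, hB]
  inv_mem' := by
    intro A hA
    simp only [Set.mem_ofPred_eq] at hA ⊢
    have h1 : (A : Matrix (Fin 3) (Fin 3) ℂ) * ((A⁻¹ : GL (Fin 3) ℂ) : Matrix (Fin 3) (Fin 3) ℂ)
        = 1 := by rw [← Units.val_mul]; simp
    have h2 : ((A⁻¹ : GL (Fin 3) ℂ) : Matrix (Fin 3) (Fin 3) ℂ)ᴴ *
        (A : Matrix (Fin 3) (Fin 3) ℂ)ᴴ = 1 := by
      rw [← Matrix.conjTranspose_mul, h1, Matrix.conjTranspose_one]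
    generalize ((A⁻¹ : GL (Fin 3) ℂ) : Matrix (Fin 3) (Fin 3) ℂ) = B at h1 h2 ⊢
    calc Bᴴ * J * B = Bᴴ * ((A : Matrix (Fin 3) (Fin 3) ℂ)ᴴ * J *
          (A : Matrix (Fin 3) (Fin 3) ℂ)) * B := by rw [hA]
      _ = (Bᴴ * (A : Matrix (Fin 3) (Fin 3) ℂ)ᴴ) * J *
          ((A : Matrix (Fin 3) (Fin 3) ℂ) * B) := by simp only [Matrix.mul_assoc]
      _ = J := by rw [h1, h2]; simp

/-- The underlying matrix of an element of `U(2,1)`. -/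
def mat (A : U21) : Matrix (Fin 3) (Fin 3) ℂ := ((A : GL (Fin 3) ℂ) : Matrix (Fin 3) (Fin 3) ℂ)

theorem mat_one : mat 1 = 1 := rfl

theorem mat_mul (A B : U21) : mat (A * B) = mat A * mat B := rfl

theorem mat_inj {A B : U21} (h : mat A = mat B) : A = B := Subtype.ext (Units.ext h)

theorem mat_mul_inv (A : U21) : mat A * mat A⁻¹ = 1 := by
  rw [← mat_mul, mul_inv_cancel, mat_one]

theorem mat_inv_mul (A : U21) : mat A⁻¹ * mat A = 1 := by
  rw [← mat_mul, inv_mul_cancel, mat_one]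

/-- The subgroup `U(1)` of unit scalar matrices, which is the centre of `U(2,1)`. -/
def scalars : Subgroup U21 where
  carrier := {A | ∃ c : ℂ, ‖c‖ = 1 ∧ mat A = c • (1 : Matrix (Fin 3) (Fin 3) ℂ)}
  one_mem' := ⟨1, by simp, by simp [mat_one]⟩
  mul_mem' := by
    rintro A B ⟨c, hc, hA⟩ ⟨d, hd, hB⟩
    exact ⟨c * d, by simp [hc, hd], by
      rw [mat_mul, hA, hB, Matrix.smul_mul, Matrix.one_mul, smul_smul]⟩
  inv_mem' := by
    rintro A ⟨c, hc, hA⟩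
    have hc0 : c ≠ 0 := by rintro rfl; simp at hc
    refine ⟨c⁻¹, by simp [hc], ?_⟩
    have h := mat_mul_inv A
    rw [hA, Matrix.smul_mul, Matrix.one_mul] at h
    rw [← h, smul_smul, inv_mul_cancel₀ hc0, one_smul]

instance scalars_normal : scalars.Normal where
  conj_mem := by
    rintro A ⟨c, hc, hA⟩ B
    refine ⟨c, hc, ?_⟩
    rw [mat_mul, mat_mul, hA, Matrix.mul_smul, Matrix.mul_one, Matrix.smul_mul,
      mat_mul_inv]

/-- The projective unitary group `PU(2,1) = U(2,1) / U(1)`, a topological group with the quotient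
topology; it is the group of holomorphic isometries of the complex hyperbolic plane. -/
abbrev PU21 : Type := U21 ⧸ scalars

/-- `U(2,1)` acts on the complex projective plane. -/
def act (A : U21) (p : CP2) : CP2 :=
  p.map (Matrix.toLin' (mat A)) (by
    intro v w h
    have h' : mat A *ᵥ v = mat A *ᵥ w := by simpa [Matrix.toLin'_apply] using h
    have h2 := congrArg (fun u => mat A⁻¹ *ᵥ u) h'
    simpa [Matrix.mulVec_mulVec, mat_inv_mul] using h2)

theorem mulVec_ne_zero (A : U21) {v : Fin 3 → ℂ} (hv : v ≠ 0) : mat A *ᵥ v ≠ 0 := by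
  intro h
  apply hv
  have h2 := congrArg (fun u => mat A⁻¹ *ᵥ u) h
  simpa [Matrix.mulVec_mulVec, mat_inv_mul] using h2

theorem act_mk (A : U21) {v : Fin 3 → ℂ} (hv : v ≠ 0) :
    act A (Projectivization.mk ℂ v hv) =
      Projectivization.mk ℂ (mat A *ᵥ v) (mulVec_ne_zero A hv) := rfl

theorem act_eq_of_scalars {A B : U21} (h : A⁻¹ * B ∈ scalars) : act A = act B := by
  obtain ⟨c, hc, h⟩ := h
  have hc0 : c ≠ 0 := by rintro rfl; simp at hc
  have hB : mat B = c • mat A := by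
    have : B = A * (A⁻¹ * B) := by group
    rw [this, mat_mul, h, Matrix.mul_smul, Matrix.mul_one]
  funext p
  induction p using Projectivization.ind with
  | h v hv =>
    rw [act_mk, act_mk, Projectivization.mk_eq_mk_iff']
    exact ⟨c⁻¹, by rw [hB, Matrix.smul_mulVec, smul_smul, inv_mul_cancel₀ hc0, one_smul]⟩

/-- The action of an element of `PU(2,1)` on the complex projective plane, through any lift. -/
def puAct (g : PU21) : CP2 → CP2 :=
  Quotient.liftOn' g act (fun _ _ h => act_eq_of_scalars (QuotientGroup.leftRel_apply.mp h))

theorem puAct_mk (A : U21) (p : CP2) : puAct (QuotientGroup.mk A) p = act A p := rfl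

/-- The action of `PU(2,1)` on the complex projective plane. -/
instance instMulActionPU21 : MulAction PU21 CP2 where
  smul := puAct
  one_smul p := by
    change puAct (QuotientGroup.mk 1) p = p
    induction p using Projectivization.ind with
    | h v hv =>
      rw [puAct_mk, act_mk]
      simp [mat_one]
  mul_smul g h p := by
    change puAct (g * h) p = puAct g (puAct h p)
    induction g using QuotientGroup.induction_on with
    | H A =>
      induction h using QuotientGroup.induction_on with
      | H B =>
        induction p using Projectivization.ind with
        | h v hv =>
          rw [← QuotientGroup.mk_mul, puAct_mk, puAct_mk, puAct_mk, act_mk, act_mk, act_mk]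
          simp [mat_mul, Matrix.mulVec_mulVec]

theorem smul_mk (A : U21) (p : CP2) : (QuotientGroup.mk A : PU21) • p = act A p := rfl

/-! ### Elliptic isometries -/

/-- An isometry is elliptic if it fixes a point of the complex hyperbolic plane. -/
def IsElliptic (g : PU21) : Prop := ∃ p ∈ H2, g • p = p

/-- A regular elliptic isometry: an elliptic isometry with three distinct eigenvalues
(the number of eigenvalues is the same for all lifts to `U(2,1)`). -/
def IsRegularElliptic (g : PU21) : Prop :=
  IsElliptic g ∧ ∃ A : U21, (QuotientGroup.mk A : PU21) = g ∧ (spectrum ℂ (mat A)).ncard = 3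

/-- The matrix `diag (e^{iθ}, e^{-iθ}, 1)`. -/
def rotMat (θ : ℝ) : Matrix (Fin 3) (Fin 3) ℂ :=
  Matrix.diagonal ![Complex.exp (θ * Complex.I), Complex.exp (-(θ * Complex.I)), 1]

theorem rotMat_mul (s t : ℝ) : rotMat s * rotMat t = rotMat (s + t) := by
  rw [rotMat, rotMat, rotMat, Matrix.diagonal_mul_diagonal]
  congr 1
  funext i
  fin_cases i
  · simp [← Complex.exp_add, add_mul]
  · simp [← Complex.exp_add, add_mul, add_comm]
  · simp

theorem rotMat_zero : rotMat 0 = 1 := by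
  rw [rotMat, ← Matrix.diagonal_one]
  congr 1
  funext i
  fin_cases i <;> simp

/-- `diag (e^{iθ}, e^{-iθ}, 1)` as an element of `U(2,1)`. -/
def rotU (θ : ℝ) : U21 :=
  ⟨⟨rotMat θ, rotMat (-θ), by rw [rotMat_mul, add_neg_cancel, rotMat_zero],
      by rw [rotMat_mul, neg_add_cancel, rotMat_zero]⟩, by
    have h : (rotMat θ)ᴴ = rotMat (-θ) := by
      rw [rotMat, rotMat, Matrix.diagonal_conjTranspose]
      congr 1
      funext i
      fin_cases i
      · simp [← Complex.exp_conj]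
      · simp [← Complex.exp_conj]
      · simp
    change (rotMat θ)ᴴ * J * rotMat θ = J
    have hc : J * rotMat θ = rotMat θ * J := by
      rw [J, rotMat, Matrix.diagonal_mul_diagonal, Matrix.diagonal_mul_diagonal]
      congr 1
      funext i
      exact mul_comm _ _
    rw [h, Matrix.mul_assoc, hc, ← Matrix.mul_assoc, rotMat_mul, neg_add_cancel, rotMat_zero,
      Matrix.one_mul]⟩

/-- A real elliptic isometry with angle `θ`: an elliptic isometry that is conjugate in `PU(2,1)`
to the element represented by `diag (e^{iθ}, e^{-iθ}, 1)`. -/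
def IsRealEllipticWithAngle (g : PU21) (θ : ℝ) : Prop :=
  IsElliptic g ∧ IsConj (QuotientGroup.mk (rotU θ) : PU21) g

/-- A real elliptic isometry. -/
def IsRealElliptic (g : PU21) : Prop := ∃ θ : ℝ, IsRealEllipticWithAngle g θ

/-! ### Lagrangian planes and the fixed torus -/

/-- The real hyperbolic plane `{[x, y, 1] | x, y real, x² + y² < 1}`, with the Bergman distance:
the totally real, totally geodesic model plane (of curvature `-1/4`). -/
def realH2 : Set CP2 :=
  {p | p ∈ H2 ∧ ∃ (v : Fin 3 → ℂ) (hv : v ≠ 0), (∀ i, (v i).im = 0) ∧ p = Projectivization.mk ℂ v hv}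

/-- A Lagrangian plane: a totally geodesic plane of `H2` that is isometric to the real hyperbolic
plane, that is, a subset of `H2` which, with the restriction of the Bergman distance of `H2`, is
isometric to `realH2`.  (As geodesics of `H2` are unique, the restricted distance makes such a
subset totally geodesic; complex geodesics are excluded by their curvature `-1`.) -/
def IsLagrangianPlane (L : Set CP2) : Prop :=
  ∃ ι : realH2 → CP2, (∀ x, ι x ∈ H2) ∧
    (∀ x y, bergmanDist (ι x) (ι y) = bergmanDist x.1 y.1) ∧ Set.range ι = L

/-- The Lagrangian planes that contain `p`, are preserved by `f`, and on which `f` does not act as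
an involution. -/
def lagrangianFamily (f : PU21) (p : CP2) : Set (Set CP2) :=
  {L | IsLagrangianPlane L ∧ p ∈ L ∧ (fun x : CP2 => f • x) '' L = L ∧ ¬ ∀ x ∈ L, f • f • x = x}

/-- The fixed torus of a regular, real elliptic isometry `f` with fixed point `p`: the union of the
ideal boundaries of the planes of `lagrangianFamily f p`. -/
def fixedTorus (f : PU21) (p : CP2) : Set CP2 := ⋃ L ∈ lagrangianFamily f p, idealBoundary L

end CHyp

end

noncomputable section

namespace CHyp

/-! ### The Hermitian form and the distance on lifts -/

/-! Choose a frame `C` in which `f` is `diag (e^{iθ₀}, e^{-iθ₀}, 1)` and let `G` be the conjugate by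
`C` of the circle of all such matrices. In the ball coordinates of `C`, the element of angle `θ`
acts as `ballRot θ`. Regularity forces `sin θ ≠ 0`, and then the centre of the ball is the only
fixed point, so it is `p_f`.

The fixed tori agree because the families of planes agree. As the two rotation angles are opposite,
`ballRot t` is a real linear combination of the identity and `ballRot θ` whenever `sin θ ≠ 0`
(`ballRot_eq_linear_combination`). A Lagrangian plane through the centre is closed under real
combinations inside the ball (`IsLagrangianPlane.linear_combination_mem`), so a plane preserved by
one such rotation is preserved by all of `G`.

This closure is derived from distances alone. Distances to the centre give norms; distances between
two points give only `|⟨z, w⟩ - 1|`. Comparing a point with its reflection in the centre shows that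
the Hermitian products are real and are given by the Lorentzian form, and equality of Gram data
makes the parametrization affine. -/

theorem herm_apply (z w : Fin 3 → ℂ) :
    herm z w = z 0 * star (w 0) + z 1 * star (w 1) - z 2 * star (w 2) := by
  simp only [herm, J, Matrix.mulVec_diagonal, dotProduct, Fin.sum_univ_three, Pi.star_apply]
  simp
  ring

theorem herm_smul_smul (a b : ℂ) (z w : Fin 3 → ℂ) :
    herm (a • z) (b • w) = a * star b * herm z w := by
  simp only [herm_apply, Pi.smul_apply, smul_eq_mul, star_mul]
  ring

theorem herm_mulVec (A : U21) (z w : Fin 3 → ℂ) : herm (mat A *ᵥ z) (mat A *ᵥ w) = herm z w := by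
  have hA : (mat A)ᴴ * J * mat A = J := A.2
  rw [herm, Matrix.star_mulVec, ← Matrix.dotProduct_mulVec, Matrix.mulVec_mulVec,
    Matrix.mulVec_mulVec, hA, herm]

theorem exists_rep_mk {v : Fin 3 → ℂ} (hv : v ≠ 0) :
    ∃ a : ℂ, a ≠ 0 ∧ (Projectivization.mk ℂ v hv).rep = a • v := by
  obtain ⟨a, ha⟩ := Projectivization.exists_smul_eq_mk_rep ℂ v hv
  exact ⟨a, a.ne_zero, ha.symm⟩

theorem mk_mem_H2_iff {v : Fin 3 → ℂ} (hv : v ≠ 0) :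
    Projectivization.mk ℂ v hv ∈ H2 ↔ (herm v v).re < 0 := by
  obtain ⟨a, ha, h⟩ := exists_rep_mk hv
  have h1 : a * star a = ((‖a‖ ^ 2 : ℝ) : ℂ) := by
    rw [Complex.star_def, Complex.mul_conj']; push_cast; rfl
  have h2 : 0 < ‖a‖ ^ 2 := by positivity
  rw [H2, Set.mem_ofPred_eq, h, herm_smul_smul, h1, Complex.re_ofReal_mul]
  constructor <;> intro h3 <;> nlinarith

theorem bergmanDist_mk {u v : Fin 3 → ℂ} (hu : u ≠ 0) (hv : v ≠ 0) :
    bergmanDist (Projectivization.mk ℂ u hu) (Projectivization.mk ℂ v hv) =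
      2 * Real.arcosh (Real.sqrt ((herm u v * herm v u) / (herm u u * herm v v)).re) := by
  obtain ⟨a, ha, h⟩ := exists_rep_mk hu
  obtain ⟨b, hb, h'⟩ := exists_rep_mk hv
  rw [bergmanDist, h, h']
  simp only [herm_smul_smul]
  have ha' : star a ≠ 0 := by simpa using ha
  have hb' : star b ≠ 0 := by simpa using hb
  congr 4
  rw [show a * star b * herm u v * (b * star a * herm v u) =
      (a * star a * b * star b) * (herm u v * herm v u) by ring,
    show a * star a * herm u u * (b * star b * herm v v) =
      (a * star a * b * star b) * (herm u u * herm v v) by ring]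
  exact mul_div_mul_left _ _ (by simp [ha, hb])

/-- The affine lift `(z₀, z₁, 1)` of a point of the ball. -/
def ballVec (z : EuclideanSpace ℂ (Fin 2)) : Fin 3 → ℂ := ![z 0, z 1, 1]

theorem ballVec_ne_zero (z : EuclideanSpace ℂ (Fin 2)) : ballVec z ≠ 0 := by
  intro h
  simpa [ballVec] using congrFun h 2

theorem herm_ballVec (z w : EuclideanSpace ℂ (Fin 2)) :
    herm (ballVec z) (ballVec w) = inner ℂ w z - 1 := by
  simp [herm_apply, ballVec, PiLp.inner_apply, Fin.sum_univ_two]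

theorem herm_ballVec_self (z : EuclideanSpace ℂ (Fin 2)) :
    herm (ballVec z) (ballVec z) = ((‖z‖ ^ 2 - 1 : ℝ) : ℂ) := by
  rw [herm_ballVec, inner_self_eq_norm_sq_to_K]
  push_cast
  rfl

/-- The point with coordinates `z` in the ball model attached to the frame `C`. -/
def ballPoint (C : U21) (z : EuclideanSpace ℂ (Fin 2)) : CP2 :=
  Projectivization.mk ℂ (mat C *ᵥ ballVec z) (mulVec_ne_zero C (ballVec_ne_zero z))

theorem ballPoint_mem_H2_iff (C : U21) (z : EuclideanSpace ℂ (Fin 2)) :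
    ballPoint C z ∈ H2 ↔ ‖z‖ < 1 := by
  rw [ballPoint, mk_mem_H2_iff, herm_mulVec, herm_ballVec_self, Complex.ofReal_re, sub_neg,
    sq_lt_one_iff_abs_lt_one, abs_norm]

theorem ballPoint_injective (C : U21) : Function.Injective (ballPoint C) := by
  intro z w h
  rw [ballPoint, ballPoint, Projectivization.mk_eq_mk_iff'] at h
  obtain ⟨a, ha⟩ := h
  have h2 := congrArg (fun u => mat C⁻¹ *ᵥ u) ha
  simp only [Matrix.mulVec_smul, Matrix.mulVec_mulVec, mat_inv_mul, Matrix.one_mulVec] at h2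
  have e2 := congrFun h2 2
  simp only [ballVec, Pi.smul_apply, smul_eq_mul, Matrix.cons_val] at e2
  obtain rfl : a = 1 := by simpa using e2
  rw [one_smul] at h2
  ext i
  fin_cases i
  · exact (congrFun h2 0).symm
  · exact (congrFun h2 1).symm

theorem exists_ballPoint (C : U21) {q : CP2} (hq : q ∈ H2) :
    ∃ z, ‖z‖ < 1 ∧ q = ballPoint C z := by
  induction q using Projectivization.ind with
  | h v hv =>
    rw [mk_mem_H2_iff] at hq
    set u := mat C⁻¹ *ᵥ v with hu
    have hCu : mat C *ᵥ u = v := by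
      rw [hu, Matrix.mulVec_mulVec, mat_mul_inv, Matrix.one_mulVec]
    have hun : (herm u u).re < 0 := by rwa [hu, herm_mulVec]
    -- The form is nonnegative on vectors with vanishing last coordinate.
    have hu2 : u 2 ≠ 0 := by
      intro h0
      rw [herm_apply, h0] at hun
      simp [Complex.mul_conj'] at hun
      norm_cast at hun
      nlinarith [sq_nonneg ‖u 0‖, sq_nonneg ‖u 1‖]
    have heq : Projectivization.mk ℂ v hv = ballPoint C (!₂[u 0 / u 2, u 1 / u 2]) := by
      rw [ballPoint, Projectivization.mk_eq_mk_iff']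
      refine ⟨u 2, ?_⟩
      rw [← Matrix.mulVec_smul, ← hCu]
      congr 1
      ext i
      fin_cases i <;> simp [ballVec] <;> field_simp
    refine ⟨_, ?_, heq⟩
    rwa [← ballPoint_mem_H2_iff C, ← heq, mk_mem_H2_iff]

theorem herm_swap (z w : Fin 3 → ℂ) : herm w z = star (herm z w) := by
  simp only [herm_apply, star_sub, star_add, star_mul, star_star]

/-- By Cauchy–Schwarz the inner product of two points of the open ball cannot equal `1`, so two
negative vectors are never orthogonal. Positivity is what allows `arcosh` and the square root to be
cancelled in an equality of distances. -/
theorem coshSq_pos {u v : Fin 3 → ℂ} (hu : (herm u u).re < 0) (hv : (herm v v).re < 0) :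
    0 < ((herm u v * herm v u) / (herm u u * herm v v)).re := by
  have real_self : ∀ z, herm z z = (((herm z z).re : ℝ) : ℂ) := fun z =>
    (Complex.conj_eq_iff_re.1 (herm_swap z z).symm).symm
  have hne : herm u v ≠ 0 := by
    have hu0 : u ≠ 0 := by rintro rfl; simp [herm_apply] at hu
    have hv0 : v ≠ 0 := by rintro rfl; simp [herm_apply] at hv
    obtain ⟨z, hz, h⟩ := exists_ballPoint 1 ((mk_mem_H2_iff hu0).2 hu)
    obtain ⟨w, hw, h'⟩ := exists_ballPoint 1 ((mk_mem_H2_iff hv0).2 hv)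
    rw [ballPoint, Projectivization.mk_eq_mk_iff'] at h h'
    obtain ⟨a, rfl⟩ := h
    obtain ⟨b, rfl⟩ := h'
    have ha : a ≠ 0 := by rintro rfl; simp at hu0
    have hb : b ≠ 0 := by rintro rfl; simp at hv0
    rw [herm_smul_smul, herm_mulVec, herm_ballVec]
    refine mul_ne_zero (mul_ne_zero ha (by simpa using hb)) (sub_ne_zero.2 fun h1 => ?_)
    have h2 := norm_inner_le_norm (𝕜 := ℂ) w z
    rw [h1, norm_one] at h2
    nlinarith [norm_nonneg z, norm_nonneg w]
  rw [herm_swap u v, Complex.star_def, Complex.mul_conj', real_self u, real_self v]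
  norm_cast
  exact div_pos (by positivity) (mul_pos_of_neg_of_neg hu hv)

theorem coshSq_eq_of_bergmanDist_eq {u v u' v' : Fin 3 → ℂ} (hu : (herm u u).re < 0)
    (hv : (herm v v).re < 0) (hu' : (herm u' u').re < 0) (hv' : (herm v' v').re < 0)
    (hu0 : u ≠ 0) (hv0 : v ≠ 0) (hu0' : u' ≠ 0) (hv0' : v' ≠ 0)
    (h : bergmanDist (Projectivization.mk ℂ u hu0) (Projectivization.mk ℂ v hv0) =
      bergmanDist (Projectivization.mk ℂ u' hu0') (Projectivization.mk ℂ v' hv0')) :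
    ((herm u v * herm v u) / (herm u u * herm v v)).re =
      ((herm u' v' * herm v' u') / (herm u' u' * herm v' v')).re := by
  rw [bergmanDist_mk, bergmanDist_mk] at h
  have p1 := coshSq_pos hu hv
  have p2 := coshSq_pos hu' hv'
  -- `Real.arcosh` is injective on all positive reals, so the bound `≥ 1` on the arguments is not
  -- needed.
  have := Real.strictMonoOn_arcosh.injOn (Real.sqrt_pos.2 p1) (Real.sqrt_pos.2 p2)
    (mul_left_cancel₀ two_ne_zero h)
  exact (Real.sqrt_inj p1.le p2.le).1 this


/-! ### The circle subgroup of `U(2,1)` -/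

theorem continuous_mat : Continuous mat := Units.continuous_val.comp continuous_subtype_val

/-- Closedness of the centre makes the quotient `PU21` Hausdorff, as required for the
compact-to-Hausdorff argument. -/
instance isClosed_scalars : IsClosed (scalars : Set U21) := by
  have h : (scalars : Set U21) =
      {A | mat A = mat A 0 0 • (1 : Matrix (Fin 3) (Fin 3) ℂ)} ∩ {A | ‖mat A 0 0‖ = 1} := by
    ext A
    constructor
    · rintro ⟨c, hc, h⟩
      have : mat A 0 0 = c := by simp [h]
      exact ⟨by rw [Set.mem_ofPred_eq, this, h], by rw [Set.mem_ofPred_eq, this, hc]⟩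
    · rintro ⟨h, hc⟩
      exact ⟨_, hc, h⟩
  have h0 : Continuous fun A : U21 => mat A 0 0 := continuous_mat.matrix_elem 0 0
  rw [h]
  exact (isClosed_eq continuous_mat (h0.smul continuous_const)).inter
    (isClosed_eq h0.norm continuous_const)

/-- `diag (z, z̄, 1)`. -/
def circleMat (z : Circle) : Matrix (Fin 3) (Fin 3) ℂ :=
  Matrix.diagonal ![(z : ℂ), ((z⁻¹ : Circle) : ℂ), 1]

theorem circleMat_one : circleMat 1 = 1 := by
  rw [circleMat, ← Matrix.diagonal_one]
  congr 1
  funext i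
  fin_cases i <;> simp

theorem circleMat_mul (z w : Circle) : circleMat (z * w) = circleMat z * circleMat w := by
  rw [circleMat, circleMat, circleMat, Matrix.diagonal_mul_diagonal]
  congr 1
  funext i
  fin_cases i <;> simp [mul_comm]

theorem circleMat_exp (θ : ℝ) : circleMat (Circle.exp θ) = rotMat θ := by
  rw [circleMat, rotMat, ← Circle.exp_neg, Circle.coe_exp, Circle.coe_exp]
  simp

theorem continuous_circleMat : Continuous circleMat := by
  refine Continuous.matrix_diagonal (continuous_pi fun i => ?_)
  fin_cases i
  · exact continuous_subtype_val
  · exact continuous_subtype_val.comp continuous_inv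
  · exact continuous_const

/-- `diag (z, z̄, 1)` as an element of `U(2,1)`. -/
def circleU : Circle →* U21 where
  toFun z := ⟨⟨circleMat z, circleMat z⁻¹, by rw [← circleMat_mul, mul_inv_cancel, circleMat_one],
    by rw [← circleMat_mul, inv_mul_cancel, circleMat_one]⟩, by
      obtain ⟨θ, rfl⟩ := Circle.exp_surjective z
      have := (rotU θ).2
      change (circleMat (Circle.exp θ))ᴴ * J * circleMat (Circle.exp θ) = J
      rw [circleMat_exp]
      exact this⟩
  map_one' := mat_inj circleMat_one
  map_mul' z w := mat_inj (circleMat_mul z w)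

theorem mat_circleU (z : Circle) : mat (circleU z) = circleMat z := rfl

theorem circleU_exp (θ : ℝ) : circleU (Circle.exp θ) = rotU θ := mat_inj (circleMat_exp θ)

theorem continuous_circleU : Continuous circleU := by
  refine Continuous.subtype_mk (Units.continuous_iff.2 ⟨?_, ?_⟩) _
  · exact continuous_circleMat
  · exact continuous_circleMat.comp continuous_inv

/-- The one-parameter group `z ↦ C diag (z, z̄, 1) C⁻¹` of `PU(2,1)`. -/
def circlePU (C : U21) : Circle →* PU21 :=
  (QuotientGroup.mk' scalars).comp ((MulAut.conj C).toMonoidHom.comp circleU)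

theorem circlePU_apply (C : U21) (z : Circle) :
    circlePU C z = (QuotientGroup.mk (C * circleU z * C⁻¹) : PU21) := rfl

theorem continuous_circlePU (C : U21) : Continuous (circlePU C) :=
  continuous_quot_mk.comp ((continuous_const.mul continuous_circleU).mul continuous_const)

/-- A scalar matrix whose last diagonal entry is `1` is the identity, so the circle meets the centre
of `U(2,1)` trivially. -/
theorem circlePU_injective (C : U21) : Function.Injective (circlePU C) := by
  rw [injective_iff_map_eq_one]
  intro z hz
  rw [circlePU_apply, QuotientGroup.eq_one_iff] at hz
  have h := scalars_normal.conj_mem _ hz C⁻¹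
  rw [show C⁻¹ * (C * circleU z * C⁻¹) * C⁻¹⁻¹ = circleU z by group] at h
  obtain ⟨c, -, h⟩ := h
  rw [mat_circleU, circleMat] at h
  have h0 := congrFun (congrFun h 0) 0
  have h2 := congrFun (congrFun h 2) 2
  simp at h0 h2
  exact Circle.ext (by rw [h0, ← h2, Circle.coe_one])

/-! ### Identification of the circle group with `SO(2)`. -/

/-- A continuous bijective homomorphism from a compact group to a Hausdorff group is an
isomorphism of topological groups. -/
def continuousMulEquivOfBijective {G H : Type*} [Group G] [Group H] [TopologicalSpace G]
    [TopologicalSpace H] [CompactSpace G] [T2Space H] (φ : G →* H) (hc : Continuous φ)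
    (hb : Function.Bijective φ) : G ≃ₜ* H :=
  { MulEquiv.ofBijective φ hb with
    continuous_toFun := hc
    continuous_invFun :=
      (Continuous.homeoOfEquivCompactToT2 (f := (MulEquiv.ofBijective φ hb).toEquiv) hc).symm.continuous }

/-- The rotation of the plane by a point of the unit circle. -/
def circleSO : Circle →* Matrix.specialOrthogonalGroup (Fin 2) ℝ where
  toFun z := ⟨!![(z : ℂ).re, -(z : ℂ).im; (z : ℂ).im, (z : ℂ).re],
    Matrix.of_mem_specialOrthogonalGroup_fin_two_iff.2 ⟨rfl, rfl, by
      have := Circle.normSq_coe z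
      rw [Complex.normSq_apply] at this
      nlinarith⟩⟩
  map_one' := by
    ext i j
    fin_cases i <;> fin_cases j <;> simp
  map_mul' z w := by
    ext i j
    fin_cases i <;> fin_cases j <;> simp <;> ring

theorem continuous_circleSO : Continuous circleSO := by
  refine Continuous.subtype_mk (continuous_matrix fun i j => ?_) _
  have h1 : Continuous fun z : Circle => (z : ℂ).re :=
    Complex.continuous_re.comp continuous_subtype_val
  have h2 : Continuous fun z : Circle => (z : ℂ).im :=
    Complex.continuous_im.comp continuous_subtype_val
  fin_cases i <;> fin_cases j
  exacts [h1, h2.neg, h2, h1]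

theorem circleSO_bijective : Function.Bijective circleSO := by
  constructor
  · intro z w h
    have h := congrArg Subtype.val h
    refine Circle.ext (Complex.ext ?_ ?_)
    · exact congrFun (congrFun h 0) 0
    · exact congrFun (congrFun h 1) 0
  · rintro ⟨M, hM⟩
    obtain ⟨h1, h2, h3⟩ := Matrix.mem_specialOrthogonalGroup_fin_two_iff.1 hM
    refine ⟨⟨⟨M 0 0, M 1 0⟩, ?_⟩, ?_⟩
    · refine mem_sphere_zero_iff_norm.2 ?_
      rw [← sq_eq_sq₀ (norm_nonneg _) zero_le_one, Complex.sq_norm, Complex.normSq_apply]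
      rw [h2] at h3
      dsimp only
      linarith
    · ext i j
      fin_cases i <;> fin_cases j <;> simp [circleSO, h1, h2]

theorem nonempty_range_circlePU_equiv (C : U21) :
    Nonempty ((circlePU C).range ≃ₜ* Matrix.specialOrthogonalGroup (Fin 2) ℝ) := by
  have hb : Function.Bijective (circlePU C).rangeRestrict :=
    ⟨(circlePU C).rangeRestrict_injective_iff.2 (circlePU_injective C),
      (circlePU C).rangeRestrict_surjective⟩
  exact ⟨(continuousMulEquivOfBijective (circlePU C).rangeRestrict
    ((continuous_circlePU C).subtype_mk _) hb).symm.trans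
      (continuousMulEquivOfBijective circleSO continuous_circleSO circleSO_bijective)⟩


/-! ### Lagrangian planes are real linear in the ball -/

/-- The real Lorentzian form. -/
def realForm (V W : Fin 3 → ℝ) : ℝ := V 0 * W 0 + V 1 * W 1 - V 2 * W 2

/-- The complexification of a real vector. -/
def realVec (V : Fin 3 → ℝ) : Fin 3 → ℂ := fun i => (V i : ℂ)

theorem herm_realVec (V W : Fin 3 → ℝ) : herm (realVec V) (realVec W) = (realForm V W : ℂ) := by
  simp [herm_apply, realVec, realForm]

theorem realVec_ne_zero {V : Fin 3 → ℝ} (hV : realForm V V < 0) : realVec V ≠ 0 := by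
  intro h
  have h' : V = 0 := funext fun i => by simpa [realVec] using congrFun h i
  simp [h', realForm] at hV

theorem mk_realVec_mem_realH2 {V : Fin 3 → ℝ} (hV : realForm V V < 0) :
    Projectivization.mk ℂ (realVec V) (realVec_ne_zero hV) ∈ realH2 :=
  ⟨(mk_mem_H2_iff _).2 (by rwa [herm_realVec, Complex.ofReal_re]),
    realVec V, realVec_ne_zero hV, fun i => Complex.ofReal_im _, rfl⟩

theorem exists_eq_mk_realVec {q : CP2} (hq : q ∈ realH2) :
    ∃ (V : Fin 3 → ℝ) (hV : realForm V V < 0),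
      q = Projectivization.mk ℂ (realVec V) (realVec_ne_zero hV) := by
  obtain ⟨hq, v, hv, him, rfl⟩ := hq
  obtain ⟨V, rfl⟩ : ∃ V, v = realVec V :=
    ⟨fun i => (v i).re, funext fun i => Complex.ext rfl (by simpa [realVec] using him i)⟩
  rw [mk_mem_H2_iff, herm_realVec, Complex.ofReal_re] at hq
  exact ⟨V, hq, rfl⟩

theorem coshSq_realVec (V W : Fin 3 → ℝ) :
    ((herm (realVec V) (realVec W) * herm (realVec W) (realVec V)) /
      (herm (realVec V) (realVec V) * herm (realVec W) (realVec W))).re =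
      realForm V W ^ 2 / (realForm V V * realForm W W) := by
  have h : realForm W V = realForm V W := by simp only [realForm]; ring
  simp only [herm_realVec, h]
  norm_cast
  rw [sq]

theorem coshSq_ballVec (C : U21) (z w : EuclideanSpace ℂ (Fin 2)) :
    ((herm (mat C *ᵥ ballVec z) (mat C *ᵥ ballVec w) *
        herm (mat C *ᵥ ballVec w) (mat C *ᵥ ballVec z)) /
      (herm (mat C *ᵥ ballVec z) (mat C *ᵥ ballVec z) *
        herm (mat C *ᵥ ballVec w) (mat C *ᵥ ballVec w))).re =
      ‖inner ℂ z w - 1‖ ^ 2 / ((‖z‖ ^ 2 - 1) * (‖w‖ ^ 2 - 1)) := by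
  simp only [herm_mulVec]
  rw [herm_swap (ballVec w) (ballVec z), herm_ballVec_self, herm_ballVec_self, herm_ballVec,
    mul_comm (star _), Complex.star_def, Complex.mul_conj']
  norm_cast

/-- A Lagrangian plane through the point `ballPoint C 0` is parametrized by the real vectors of an
affine chart of the real hyperbolic plane. -/
theorem exists_lagrangian_chart {L : Set CP2} (hL : IsLagrangianPlane L) (C : U21)
    (h0 : ballPoint C 0 ∈ L) :
    ∃ (X : Fin 3 → ℝ) (j : (Fin 3 → ℝ) → EuclideanSpace ℂ (Fin 2)), realForm X X = -1 ∧
      (∀ V, realForm V V < 0 → ballPoint C (j V) ∈ L) ∧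
      (∀ z, ballPoint C z ∈ L → ∃ V, realForm V V < 0 ∧ realForm V X = -1 ∧ j V = z) ∧
      (∀ V, realForm V V < 0 → realForm V X = -1 → ‖j V‖ ^ 2 = realForm V V + 1) ∧
      ∀ V W, realForm V V < 0 → realForm V X = -1 → realForm W W < 0 → realForm W X = -1 →
        ‖inner ℂ (j V) (j W) - 1‖ ^ 2 = realForm V W ^ 2 := by
  obtain ⟨ι, hι, hd, rfl⟩ := hL
  -- The chart is made total on real vectors; its value `0` off the negative cone is a dummy.
  have hex : ∀ V, ∃ z, ∀ hV : realForm V V < 0, ι ⟨_, mk_realVec_mem_realH2 hV⟩ = ballPoint C z := by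
    intro V
    by_cases hV : realForm V V < 0
    · obtain ⟨z, -, hz⟩ := exists_ballPoint C (hι ⟨_, mk_realVec_mem_realH2 hV⟩)
      exact ⟨z, fun _ => hz⟩
    · exact ⟨0, fun h => absurd h hV⟩
  choose j hj using hex
  have hn : ∀ V, realForm V V < 0 → ‖j V‖ ^ 2 - 1 < 0 := by
    intro V hV
    have h : ‖j V‖ < 1 := by
      rw [← ballPoint_mem_H2_iff C, ← hj V hV]
      exact hι _
    nlinarith [norm_nonneg (j V)]
  have key : ∀ V W, realForm V V < 0 → realForm W W < 0 →
      ‖inner ℂ (j V) (j W) - 1‖ ^ 2 / ((‖j V‖ ^ 2 - 1) * (‖j W‖ ^ 2 - 1)) =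
        realForm V W ^ 2 / (realForm V V * realForm W W) := by
    intro V W hV hW
    have h := hd ⟨_, mk_realVec_mem_realH2 hV⟩ ⟨_, mk_realVec_mem_realH2 hW⟩
    rw [hj V hV, hj W hW] at h
    have hr : ∀ U, realForm U U < 0 → (herm (realVec U) (realVec U)).re < 0 := fun U hU => by
      rwa [herm_realVec, Complex.ofReal_re]
    have hb : ∀ U, realForm U U < 0 →
        (herm (mat C *ᵥ ballVec (j U)) (mat C *ᵥ ballVec (j U))).re < 0 := fun U hU => by
      rw [herm_mulVec, herm_ballVec_self, Complex.ofReal_re]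
      exact hn U hU
    have h' := coshSq_eq_of_bergmanDist_eq (hb V hV) (hb W hW) (hr V hV) (hr W hW) _ _ _ _ h
    rwa [coshSq_ballVec, coshSq_realVec] at h'
  have hsurj : ∀ z, ballPoint C z ∈ Set.range ι → ∃ V, realForm V V < 0 ∧ j V = z := by
    rintro z ⟨⟨q, hq⟩, hz⟩
    obtain ⟨V, hV, rfl⟩ := exists_eq_mk_realVec hq
    exact ⟨V, hV, ballPoint_injective C ((hj V hV).symm.trans hz)⟩
  have hsmul : ∀ (a : ℝ) V, a ≠ 0 → realForm V V < 0 →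
      realForm (a • V) (a • V) < 0 ∧ j (a • V) = j V := by
    intro a V ha hV
    have hV' : realForm (a • V) (a • V) < 0 := by
      have : realForm (a • V) (a • V) = a ^ 2 * realForm V V := by
        simp only [realForm, Pi.smul_apply, smul_eq_mul]; ring
      rw [this]
      have : 0 < a ^ 2 := by positivity
      nlinarith
    refine ⟨hV', ballPoint_injective C ?_⟩
    rw [← hj V hV, ← hj _ hV']
    congr 2
    rw [Projectivization.mk_eq_mk_iff']
    refine ⟨(a : ℂ), ?_⟩
    funext i
    simp [realVec]
  obtain ⟨X', hX', hjX'⟩ := hsurj 0 h0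
  -- The lift of the centre is normalized to the hyperboloid. Points of the plane will be lifted to
  -- the affine slice `realForm V X = -1`, on which both distance formulas lose their denominators.
  obtain ⟨X, hX, hjX⟩ : ∃ X, realForm X X = -1 ∧ j X = 0 := by
    have hpos : 0 < √(-realForm X' X') := Real.sqrt_pos.2 (by linarith)
    refine ⟨(√(-realForm X' X'))⁻¹ • X', ?_, ?_⟩
    · have hs := Real.sq_sqrt (show 0 ≤ -realForm X' X' by linarith)
      have : realForm ((√(-realForm X' X'))⁻¹ • X') ((√(-realForm X' X'))⁻¹ • X') =
          (√(-realForm X' X') ^ 2)⁻¹ * realForm X' X' := by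
        generalize √(-realForm X' X') = s
        simp only [realForm, Pi.smul_apply, smul_eq_mul]
        ring
      rw [this, hs, inv_neg, neg_mul, inv_mul_cancel₀ hX'.ne]
    · rw [(hsmul _ X' (inv_ne_zero hpos.ne') hX').2, hjX']
  have hX1 : realForm X X < 0 := by rw [hX]; norm_num
  have hnorm : ∀ V, realForm V V < 0 → realForm V X = -1 → ‖j V‖ ^ 2 = realForm V V + 1 := by
    intro V hV hVX
    have h := key V X hV hX1
    have h1 := hn V hV
    rw [hjX, hVX, hX] at h
    simp only [inner_zero_right, norm_zero] at h
    norm_num at h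
    rw [inv_eq_iff_eq_inv, inv_neg, inv_inv] at h
    linarith
  refine ⟨X, j, hX, fun V hV => ⟨_, hj V hV⟩, ?_, hnorm, ?_⟩
  · intro z hz
    obtain ⟨V, hV, hVz⟩ := hsurj z hz
    have hVX : realForm V X ≠ 0 := by
      intro h
      have hr : ∀ U, realForm U U < 0 → (herm (realVec U) (realVec U)).re < 0 := fun U hU => by
        rwa [herm_realVec, Complex.ofReal_re]
      have h' := coshSq_pos (hr V hV) (hr X hX1)
      rw [coshSq_realVec, h] at h'
      simp at h'
    -- This factor, of either sign, rescales `V` into the slice; `j` does not see it, being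
    -- projectively invariant.
    have ha : -(realForm V X)⁻¹ ≠ 0 := neg_ne_zero.2 (inv_ne_zero hVX)
    obtain ⟨h1, h2⟩ := hsmul _ V ha hV
    refine ⟨_, h1, ?_, h2.trans hVz⟩
    have : realForm (-(realForm V X)⁻¹ • V) X = -(realForm V X)⁻¹ * realForm V X := by
      generalize -(realForm V X)⁻¹ = a
      simp only [realForm, Pi.smul_apply, smul_eq_mul]
      ring
    rw [this, neg_mul, inv_mul_cancel₀ hVX]
  · intro V W hV hVX hW hWX
    have h := key V W hV hW
    rw [hnorm V hV hVX, hnorm W hW hWX, add_sub_cancel_right, add_sub_cancel_right] at h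
    exact (div_left_inj' (mul_pos_of_neg_of_neg hV hW).ne').1 h

theorem norm_sub_one_sq (h : ℂ) : ‖h - 1‖ ^ 2 = ‖h‖ ^ 2 - 2 * h.re + 1 := by
  simp only [Complex.sq_norm, Complex.normSq_apply, Complex.sub_re, Complex.sub_im, Complex.one_re,
    Complex.one_im]
  ring

/-- A Lagrangian plane through the centre of the ball is stable under the real linear combinations
that stay in the ball. -/
theorem IsLagrangianPlane.linear_combination_mem {L : Set CP2} (hL : IsLagrangianPlane L) (C : U21)
    (h0 : ballPoint C 0 ∈ L) {z w : EuclideanSpace ℂ (Fin 2)} (hz : ballPoint C z ∈ L)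
    (hw : ballPoint C w ∈ L) (a b : ℝ) (hab : ‖a • z + b • w‖ < 1) :
    ballPoint C (a • z + b • w) ∈ L := by
  obtain ⟨X, j, hX, hjL, hsurj, hnorm, hinner⟩ := exists_lagrangian_chart hL C h0
  have hreal : ∀ V W, realForm V V < 0 → realForm V X = -1 → realForm W W < 0 →
      realForm W X = -1 → inner ℂ (j V) (j W) = ((realForm V W + 1 : ℝ) : ℂ) := by
    intro V W hV hVX hW hWX
    -- `V'` is the reflection of `V` in the centre, taken within the slice.
    set V' := (2 : ℝ) • X - V with hV'
    have e1 : ∀ U, realForm V' U = 2 * realForm U X - realForm V U := fun U => by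
      simp only [hV', realForm, Pi.smul_apply, Pi.sub_apply, smul_eq_mul]; ring
    have e2 : realForm V' V' = realForm V V := by
      have : realForm V' V' = 4 * realForm X X - 4 * realForm V X + realForm V V := by
        simp only [hV', realForm, Pi.smul_apply, Pi.sub_apply, smul_eq_mul]; ring
      rw [this, hX, hVX]; ring
    have e3 : realForm V' X = -1 := by rw [e1, hX, hVX]; norm_num
    have hneg : j V' = -j V := by
      have h1 := hinner V' V (by rwa [e2]) e3 hV hVX
      have n1 := hnorm V' (by rwa [e2]) e3
      have n2 := hnorm V hV hVX
      rw [e2, ← n2] at n1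
      rw [e1, hVX, norm_sub_one_sq] at h1
      have h2 := norm_inner_le_norm (𝕜 := ℂ) (j V') (j V)
      have h3 : ‖j V'‖ = ‖j V‖ := by
        rwa [sq_eq_sq₀ (norm_nonneg _) (norm_nonneg _)] at n1
      rw [h3] at h2
      have h4 := @norm_add_sq ℂ _ _ _ _ (j V') (j V)
      rw [RCLike.re_to_complex] at h4
      -- With `h` this product and `n = ‖j V‖²`, the distance gives `|h|² - 2 Re h + 1 = (n + 1)²`.
      -- Hence `|h|² ≤ n²` forces `Re h ≤ -n`, and `‖j V' + j V‖² = 2n + 2 Re h ≤ 0`.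
      have h5 : ‖(inner ℂ (j V') (j V) : ℂ)‖ ^ 2 ≤ (‖j V‖ ^ 2) ^ 2 := by
        rw [sq (‖j V‖)]
        exact pow_le_pow_left₀ (norm_nonneg _) h2 2
      have h6 : ‖j V' + j V‖ ^ 2 ≤ 0 := by
        rw [h4, n1]
        nlinarith
      have h7 : ‖j V' + j V‖ = 0 := by nlinarith [sq_nonneg ‖j V' + j V‖, norm_nonneg (j V' + j V)]
      exact eq_neg_of_add_eq_zero_left (norm_eq_zero.1 h7)
    have i1 := hinner V W hV hVX hW hWX
    have i2 := hinner V' W (by rwa [e2]) e3 hW hWX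
    rw [hneg, inner_neg_left, e1, hWX, norm_sub_one_sq, norm_neg, Complex.neg_re] at i2
    rw [norm_sub_one_sq] at i1
    -- Replacing `V` by `V'` changes the sign of the product, so subtracting `i1` from `i2` isolates
    -- its real part. Then `i1` gives the modulus, which leaves no imaginary part.
    have hre : (inner ℂ (j V) (j W) : ℂ).re = realForm V W + 1 := by nlinarith
    have him : (inner ℂ (j V) (j W) : ℂ).im = 0 := by
      rw [Complex.sq_norm, Complex.normSq_apply, hre] at i1
      nlinarith
    exact Complex.ext (by rw [hre, Complex.ofReal_re]) (by rw [him, Complex.ofReal_im])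
  obtain ⟨V, hV, hVX, rfl⟩ := hsurj z hz
  obtain ⟨W, hW, hWX, rfl⟩ := hsurj w hw
  -- The coefficient of `X` keeps `U` in the slice `realForm U X = -1`; as `X` maps to the centre,
  -- the expected image is `a • j V + b • j W`.
  set U := (1 - a - b) • X + a • V + b • W with hU
  have f1 : ∀ Y, realForm U Y = (1 - a - b) * realForm Y X + a * realForm V Y
      + b * realForm W Y := fun Y => by
    simp only [hU, realForm, Pi.smul_apply, Pi.add_apply, smul_eq_mul]; ring
  have sym : ∀ Y Z, realForm Y Z = realForm Z Y := fun Y Z => by simp only [realForm]; ring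
  have hUX : realForm U X = -1 := by rw [f1, hX, hVX, hWX]; ring
  have hUV : realForm U V + 1 = a * (realForm V V + 1) + b * (realForm V W + 1) := by
    rw [f1, hVX, sym W V]; ring
  have hUW : realForm U W + 1 = a * (realForm V W + 1) + b * (realForm W W + 1) := by
    rw [f1, hWX]; ring
  have hUU : realForm U U + 1 = a * (realForm U V + 1) + b * (realForm U W + 1) := by
    rw [f1 U, hUX, sym V U, sym W U]; ring
  have hsm : ∀ (c : ℝ) (v : EuclideanSpace ℂ (Fin 2)), c • v = (c : ℂ) • v := fun c v =>
    (Complex.coe_smul c v).symm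
  have hinner_smul : ∀ (c : ℝ) (u v : EuclideanSpace ℂ (Fin 2)),
      (inner ℂ u (c • v) : ℂ) = (c : ℂ) * inner ℂ u v := fun c u v => by
    rw [hsm, inner_smul_right]
  have hsq : ‖a • j V + b • j W‖ ^ 2 = realForm U U + 1 := by
    have h1 := @norm_add_sq ℂ _ _ _ _ (a • j V) (b • j W)
    rw [norm_smul, norm_smul, mul_pow, mul_pow, hnorm V hV hVX, hnorm W hW hWX, RCLike.re_to_complex,
      hinner_smul, hsm a, inner_smul_left, hreal V W hV hVX hW hWX, Complex.conj_ofReal,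
      ← Complex.ofReal_mul, ← Complex.ofReal_mul, Complex.ofReal_re, Real.norm_eq_abs,
      Real.norm_eq_abs, sq_abs, sq_abs] at h1
    rw [hsm a, h1, hUU, hUV, hUW]
    ring
  have hUneg : realForm U U < 0 := by nlinarith [norm_nonneg (a • j V + b • j W)]
  -- The squared norm of the difference expands into products already known, and they cancel.
  have heq : j U = a • j V + b • j W := by
    have h1 := @norm_sub_sq ℂ _ _ _ _ (j U) (a • j V + b • j W)
    rw [inner_add_right, hinner_smul, hinner_smul, hreal U V hUneg hUX hV hVX,
      hreal U W hUneg hUX hW hWX, hsq, hnorm U hUneg hUX, RCLike.re_to_complex,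
      ← Complex.ofReal_mul, ← Complex.ofReal_mul, ← Complex.ofReal_add, Complex.ofReal_re,
      ← hUU] at h1
    rw [← sub_eq_zero, ← norm_eq_zero, ← sq_eq_zero_iff, h1]
    ring
  rw [← heq]
  exact hjL U hUneg


/-! ### Rotations in the ball -/

/-- The rotation `(z₀, z₁) ↦ (e^{iθ} z₀, e^{-iθ} z₁)` of the ball. -/
def ballRot (θ : ℝ) (z : EuclideanSpace ℂ (Fin 2)) : EuclideanSpace ℂ (Fin 2) :=
  !₂[Complex.exp (θ * Complex.I) * z 0, Complex.exp (-(θ * Complex.I)) * z 1]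

theorem circlePU_smul_ballPoint (C : U21) (θ : ℝ) (z : EuclideanSpace ℂ (Fin 2)) :
    circlePU C (Circle.exp θ) • ballPoint C z = ballPoint C (ballRot θ z) := by
  have h : mat (C * circleU (Circle.exp θ) * C⁻¹) *ᵥ (mat C *ᵥ ballVec z) =
      mat C *ᵥ ballVec (ballRot θ z) := by
    rw [circleU_exp, mat_mul, mat_mul, Matrix.mulVec_mulVec, Matrix.mul_assoc, mat_inv_mul,
      Matrix.mul_one, ← Matrix.mulVec_mulVec]
    congr 1
    change rotMat θ *ᵥ ballVec z = _
    rw [rotMat]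
    ext i
    fin_cases i <;> simp [Matrix.mulVec_diagonal, ballVec, ballRot]
  rw [circlePU_apply, smul_mk, ballPoint, act_mk]
  simp only [h]
  rfl

theorem norm_ballRot (θ : ℝ) (z : EuclideanSpace ℂ (Fin 2)) : ‖ballRot θ z‖ = ‖z‖ := by
  have h : ‖Complex.exp (-(θ * Complex.I))‖ = 1 := by
    simpa using Complex.norm_exp_ofReal_mul_I (-θ)
  simp [EuclideanSpace.norm_eq, ballRot, Fin.sum_univ_two, h]

theorem ballRot_zero (θ : ℝ) : ballRot θ 0 = 0 := by
  rw [← norm_eq_zero, norm_ballRot, norm_zero]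

theorem ballRot_ballRot (s t : ℝ) (z : EuclideanSpace ℂ (Fin 2)) :
    ballRot s (ballRot t z) = ballRot (s + t) z := by
  ext i
  fin_cases i
  · simp [ballRot, add_mul, Complex.exp_add, mul_assoc]
  · simp [ballRot, add_mul, Complex.exp_add]
    ring

theorem eq_zero_of_ballRot_eq {θ : ℝ} (hθ : Complex.exp (θ * Complex.I) ≠ 1)
    {z : EuclideanSpace ℂ (Fin 2)} (h : ballRot θ z = z) : z = 0 := by
  have h0 := congrArg (fun u : EuclideanSpace ℂ (Fin 2) => u 0) h
  have h1 := congrArg (fun u : EuclideanSpace ℂ (Fin 2) => u 1) h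
  simp only [ballRot, PiLp.toLp_apply, Matrix.cons_val_zero, Matrix.cons_val_one] at h0 h1
  have hθ' : Complex.exp (-(θ * Complex.I)) ≠ 1 := by
    rw [Complex.exp_neg]
    exact fun h => hθ (inv_eq_one.1 h)
  ext i
  fin_cases i
  · by_contra hz
    exact hθ (mul_eq_right₀ hz |>.1 h0)
  · by_contra hz
    exact hθ' (mul_eq_right₀ hz |>.1 h1)

/-- Since `e^{iθ}` is not real, `1` and `e^{iθ}` span `ℂ` over `ℝ`, so `e^{it} = a + b e^{iθ}` with
`a, b` real. Conjugating, the same `a, b` serve the second coordinate; this is where real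
ellipticity enters. -/
theorem ballRot_eq_linear_combination {θ : ℝ} (hθ : Real.sin θ ≠ 0) (t : ℝ)
    (z : EuclideanSpace ℂ (Fin 2)) :
    ballRot t z = (Real.cos t - Real.sin t / Real.sin θ * Real.cos θ) • z +
      (Real.sin t / Real.sin θ) • ballRot θ z := by
  set b := Real.sin t / Real.sin θ with hb
  have hs : Real.sin t = b * Real.sin θ := by rw [hb, div_mul_cancel₀ _ hθ]
  have e1 : ∀ s : ℝ, Complex.exp (s * Complex.I) = ⟨Real.cos s, Real.sin s⟩ := fun s =>
    Complex.ext (Complex.exp_ofReal_mul_I_re s) (Complex.exp_ofReal_mul_I_im s)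
  have e2 : ∀ s : ℝ, Complex.exp (-(s * Complex.I)) = ⟨Real.cos s, -Real.sin s⟩ := fun s => by
    have := e1 (-s)
    rwa [Real.cos_neg, Real.sin_neg, Complex.ofReal_neg, neg_mul] at this
  ext i
  fin_cases i
  · simp only [ballRot, e1, e2, hs]
    apply Complex.ext <;> simp [Complex.cos_ofReal_re] <;> ring
  · simp only [ballRot, e1, e2, hs]
    apply Complex.ext <;> simp [Complex.cos_ofReal_re] <;> ring

theorem exp_mul_I_ne_one {θ : ℝ} (hθ : Real.sin θ ≠ 0) : Complex.exp (θ * Complex.I) ≠ 1 := by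
  intro h
  apply hθ
  rw [← Complex.exp_ofReal_mul_I_im, h, Complex.one_im]

theorem exp_add_self_mul_I_ne_one {θ : ℝ} (hθ : Real.sin θ ≠ 0) :
    Complex.exp ((θ + θ : ℝ) * Complex.I) ≠ 1 := by
  intro h
  have h1 := Complex.exp_ofReal_mul_I_re (θ + θ)
  rw [h, Complex.one_re, ← two_mul, Real.cos_two_mul, Real.cos_sq'] at h1
  exact hθ (sq_eq_zero_iff.1 (by linarith))

/-! ### The invariant Lagrangian planes -/

/-- If `z` and `ballRot θ z` are coordinates of points of `L`, so is their combination `ballRot t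
z`, whose norm is still that of `z`. Applying this to `-t` as well turns the inclusion into an
equality. -/
theorem IsLagrangianPlane.image_circlePU_eq {L : Set CP2} (hL : IsLagrangianPlane L) {C : U21}
    (h0 : ballPoint C 0 ∈ L) {θ : ℝ} (hθ : Real.sin θ ≠ 0)
    (hinv : (fun x : CP2 => circlePU C (Circle.exp θ) • x) '' L = L) (t : ℝ) :
    (fun x : CP2 => circlePU C (Circle.exp t) • x) '' L = L := by
  have hsub : L ⊆ H2 := by
    obtain ⟨ι, hι, -, rfl⟩ := hL
    rintro _ ⟨x, rfl⟩
    exact hι x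
  have key : ∀ t : ℝ, ∀ x ∈ L, circlePU C (Circle.exp t) • x ∈ L := by
    intro t x hx
    obtain ⟨z, hz, rfl⟩ := exists_ballPoint C (hsub hx)
    have h1 : ballPoint C (ballRot θ z) ∈ L := by
      rw [← circlePU_smul_ballPoint, ← hinv]
      exact ⟨_, hx, rfl⟩
    rw [circlePU_smul_ballPoint, ballRot_eq_linear_combination hθ t]
    refine hL.linear_combination_mem C h0 hx h1 _ _ ?_
    rwa [← ballRot_eq_linear_combination hθ t, norm_ballRot]
  refine Set.Subset.antisymm (Set.image_subset_iff.2 (key t)) fun x hx => ?_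
  refine ⟨_, key (-t) x hx, ?_⟩
  dsimp only
  rw [smul_smul, ← map_mul, ← Circle.exp_add, add_neg_cancel, Circle.exp_zero, map_one, one_smul]

theorem lagrangianFamily_circlePU_subset (C : U21) {θ t : ℝ} (hθ : Real.sin θ ≠ 0)
    (ht : Real.sin t ≠ 0) :
    lagrangianFamily (circlePU C (Circle.exp θ)) (ballPoint C 0) ⊆
      lagrangianFamily (circlePU C (Circle.exp t)) (ballPoint C 0) := by
  rintro L ⟨hL, h0, hinv, hne⟩
  refine ⟨hL, h0, hL.image_circlePU_eq h0 hθ hinv t, fun hid => hne fun x hx => ?_⟩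
  obtain ⟨z, -, rfl⟩ : ∃ z, ‖z‖ < 1 ∧ x = ballPoint C z := by
    obtain ⟨ι, hι, -, rfl⟩ := hL
    obtain ⟨y, rfl⟩ := hx
    exact exists_ballPoint C (hι y)
  have h := hid _ hx
  rw [circlePU_smul_ballPoint, circlePU_smul_ballPoint, ballRot_ballRot] at h
  -- An involution at angle `t` means that the rotation by `2t` fixes the point; since `sin t ≠ 0`
  -- the point is the centre, which every rotation fixes.
  rw [eq_zero_of_ballRot_eq (exp_add_self_mul_I_ne_one ht) (ballPoint_injective C h),
    circlePU_smul_ballPoint, circlePU_smul_ballPoint, ballRot_zero, ballRot_zero]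

theorem fixedTorus_circlePU_eq (C : U21) {θ t : ℝ} (hθ : Real.sin θ ≠ 0) (ht : Real.sin t ≠ 0) :
    fixedTorus (circlePU C (Circle.exp θ)) (ballPoint C 0) =
      fixedTorus (circlePU C (Circle.exp t)) (ballPoint C 0) := by
  rw [fixedTorus, fixedTorus, (lagrangianFamily_circlePU_subset C hθ ht).antisymm
    (lagrangianFamily_circlePU_subset C ht hθ)]

/-! ### Fixed points, regularity and the diagonal normal form. -/

theorem ballPoint_zero_mem_H2 (C : U21) : ballPoint C 0 ∈ H2 := by
  rw [ballPoint_mem_H2_iff, norm_zero]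
  exact one_pos

theorem circlePU_smul_ballPoint_zero (C : U21) (θ : ℝ) :
    circlePU C (Circle.exp θ) • ballPoint C 0 = ballPoint C 0 := by
  rw [circlePU_smul_ballPoint, ballRot_zero]

theorem eq_ballPoint_zero_of_fixed (C : U21) {θ : ℝ} (hθ : Real.sin θ ≠ 0) {q : CP2}
    (hq : q ∈ H2) (h : circlePU C (Circle.exp θ) • q = q) : q = ballPoint C 0 := by
  obtain ⟨z, -, rfl⟩ := exists_ballPoint C hq
  rw [circlePU_smul_ballPoint] at h
  rw [eq_zero_of_ballRot_eq (exp_mul_I_ne_one hθ) (ballPoint_injective C h)]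

/-- If a lift squares to a scalar `c`, its eigenvalues are square roots of `c`, so there are at most
two. -/
theorem IsRegularElliptic.mul_self_ne_one {g : PU21} (hg : IsRegularElliptic g) : g * g ≠ 1 := by
  obtain ⟨-, A, rfl, hA⟩ := hg
  intro h
  rw [← QuotientGroup.mk_mul, QuotientGroup.eq_one_iff] at h
  obtain ⟨c, -, hc⟩ := h
  rw [mat_mul] at hc
  have hsq : ∀ μ ∈ spectrum ℂ (mat A), μ ^ 2 = c := by
    intro μ hμ
    rw [← Matrix.spectrum_toLin', ← Module.End.hasEigenvalue_iff_mem_spectrum] at hμ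
    obtain ⟨v, hv⟩ := hμ.exists_hasEigenvector
    have h1 : mat A *ᵥ v = μ • v := by simpa using hv.apply_eq_smul
    have h2 := congrArg (fun M => M *ᵥ v) hc
    simp only [← Matrix.mulVec_mulVec, h1, Matrix.mulVec_smul, Matrix.smul_mulVec,
      Matrix.one_mulVec, smul_smul] at h2
    rw [sq]
    exact smul_left_injective ℂ hv.2 h2
  obtain ⟨μ, hμ⟩ : (spectrum ℂ (mat A)).Nonempty :=
    Set.nonempty_of_ncard_ne_zero (by rw [hA]; norm_num)
  have hsub : spectrum ℂ (mat A) ⊆ {μ, -μ} := fun ν hν =>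
    sq_eq_sq_iff_eq_or_eq_neg.1 ((hsq ν hν).trans (hsq μ hμ).symm)
  have h1 := Set.ncard_le_ncard hsub (Set.toFinite _)
  have h2 : ({μ, -μ} : Set ℂ).ncard ≤ 1 + 1 :=
    (Set.ncard_insert_le _ _).trans (by rw [Set.ncard_singleton])
  omega

/-- When `sin θ = 0`, the rotation by `2θ` is trivial, so the element squares to `1`. -/
theorem sin_ne_zero_of_isRegularElliptic {C : U21} {θ : ℝ}
    (h : IsRegularElliptic (circlePU C (Circle.exp θ))) : Real.sin θ ≠ 0 := by
  intro hs
  apply h.mul_self_ne_one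
  have h1 : Circle.exp (θ + θ) = 1 := by
    apply Circle.ext
    rw [Circle.coe_exp, Circle.coe_one]
    apply Complex.ext
    · rw [Complex.exp_ofReal_mul_I_re, ← two_mul, Real.cos_two_mul, Real.cos_sq', hs]
      norm_num
    · rw [Complex.exp_ofReal_mul_I_im, ← two_mul, Real.sin_two_mul, hs]
      simp
  rw [← map_mul, ← Circle.exp_add, h1, map_one]

theorem isRealEllipticWithAngle_circlePU (C : U21) (θ : ℝ) :
    IsRealEllipticWithAngle (circlePU C (Circle.exp θ)) θ := by
  refine ⟨⟨_, ballPoint_zero_mem_H2 C, circlePU_smul_ballPoint_zero C θ⟩,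
    isConj_iff.2 ⟨(QuotientGroup.mk C : PU21), ?_⟩⟩
  rw [circlePU_apply, circleU_exp]
  rfl

theorem exists_eq_circlePU {g : PU21} (hg : IsRealElliptic g) :
    ∃ (C : U21) (θ : ℝ), g = circlePU C (Circle.exp θ) := by
  obtain ⟨θ, -, h⟩ := hg
  obtain ⟨c, hc⟩ := isConj_iff.1 h
  obtain ⟨C, rfl⟩ := QuotientGroup.mk_surjective c
  refine ⟨C, θ, ?_⟩
  rw [circlePU_apply, circleU_exp, ← hc]
  rfl

end CHyp

end

/-! ### The one-parameter group of `f`. -/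

theorem mainTheorem7 (f : CHyp.PU21) (hreg : CHyp.IsRegularElliptic f)
    (hreal : CHyp.IsRealElliptic f)
    (p : CHyp.CP2) (hp : p ∈ CHyp.H2) (hfp : f • p = p) :
    ∃ (G : Subgroup CHyp.PU21) (F : ℝ → CHyp.PU21),
      Continuous F ∧ (∀ s t : ℝ, F (s + t) = F s * F t) ∧
      (G : Set CHyp.PU21) = F '' Set.Ico 0 (2 * Real.pi) ∧
      Nonempty (G ≃ₜ* Matrix.specialOrthogonalGroup (Fin 2) ℝ) ∧
      f ∈ G ∧
      ∀ θ ∈ Set.Ico (0 : ℝ) (2 * Real.pi),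
        CHyp.IsRealEllipticWithAngle (F θ) θ ∧
        (CHyp.IsRegularElliptic (F θ) →
          {q : CHyp.CP2 | q ∈ CHyp.H2 ∧ F θ • q = q} = {p} ∧
          CHyp.fixedTorus (F θ) p = CHyp.fixedTorus f p) := by
  obtain ⟨C, θ₀, rfl⟩ := CHyp.exists_eq_circlePU hreal
  have hθ₀ := CHyp.sin_ne_zero_of_isRegularElliptic hreg
  -- Uniqueness of the fixed point identifies the given `p` with the centre of the frame, whichever
  -- frame diagonalizes `f`.
  obtain rfl := CHyp.eq_ballPoint_zero_of_fixed C hθ₀ hp hfp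
  refine ⟨(CHyp.circlePU C).range, fun θ => CHyp.circlePU C (Circle.exp θ),
    (CHyp.continuous_circlePU C).comp Circle.exp.continuous, fun s t => ?_, ?_,
    CHyp.nonempty_range_circlePU_equiv C, ⟨_, rfl⟩, fun θ _ =>
      ⟨CHyp.isRealEllipticWithAngle_circlePU C θ, fun h => ?_⟩⟩
  · simp only [Circle.exp_add, map_mul]
  · ext g
    constructor
    · rintro ⟨z, rfl⟩
      obtain ⟨θ, rfl⟩ := Circle.exp_surjective z
      obtain ⟨s, hs, h⟩ := Circle.periodic_exp.exists_mem_Ico₀ Real.two_pi_pos θ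
      exact ⟨s, hs, by rw [h]⟩
    · rintro ⟨θ, -, rfl⟩
      exact ⟨_, rfl⟩
  · have hθ := CHyp.sin_ne_zero_of_isRegularElliptic h
    refine ⟨Set.eq_singleton_iff_unique_mem.2 ⟨⟨hp, CHyp.circlePU_smul_ballPoint_zero C θ⟩,
      fun q hq => CHyp.eq_ballPoint_zero_of_fixed C hθ hq.1 hq.2⟩,
      CHyp.fixedTorus_circlePU_eq C hθ hθ₀⟩
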